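/- Pólya's theorem. Let $d \ge 1$ be an integer and let $\mathbb{Z}^d$ be the $d$-dimensional integer lattice: the graph whose vertices are the points of $\mathbb{R}^d$ with integer coordinates, each vertex being joined by an edge to its $2d$ nearest neighbours (the points at distance $1$ along a coordinate axis). Simple random walk on $\mathbb{Z}^d$ started at a vertex $x$ is the Markov chain $(X_n)_{n\ge 0}$ with $X_0 = x$ which at each step moves from its current vertex to one of the $2d$ neighbours of that vertex, each chosen with probability $\tfrac{1}{2d}$. Let $p_{\mathrm{esc}} = \mathbb{P}(X_n \ne x \text{ for all } n \ge 1)$ be the probability that the walk never returns to its starting point. The walk is called recurrent if $p_{\mathrm{esc}} = 0$ and transient if $p_{\mathrm{esc}} > 0$. Then, for every starting point $x \in \mathbb{Z}^d$, simple random walk on $\mathbb{Z}^d$ is recurrent if $d = 1$ or $d = 2$, and transient if $d \ge 3$. -/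

import Mathlib

open MeasureTheory ProbabilityTheory

namespace RandomWalk

/-- The `d`-dimensional integer lattice: the vertices are the integer points, and two vertices are
joined by an edge exactly when they are at distance one along a coordinate axis. -/
def lattice (d : ℕ) : SimpleGraph (Fin d → ℤ) where
  Adj x y := ∑ i, |x i - y i| = 1
  symm := ⟨fun x y h => by simpa only [abs_sub_comm] using h⟩
  loopless := ⟨fun x h => by simp at h⟩

theorem lattice_neighborSet_finite (d : ℕ) (x : Fin d → ℤ) :
    ((lattice d).neighborSet x).Finite := by
  refine (Set.finite_Icc (fun i => x i - 1) (fun i => x i + 1)).subset ?_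
  intro y hy
  have hs : ∑ i, |x i - y i| = 1 := hy
  have h : ∀ i, |x i - y i| ≤ 1 := fun i => hs ▸
    Finset.single_le_sum (f := fun i => |x i - y i|) (fun j _ => abs_nonneg _) (Finset.mem_univ i)
  constructor <;> intro i <;> have := abs_le.mp (h i) <;> simp only <;> omega

noncomputable instance latticeLocallyFinite (d : ℕ) : (lattice d).LocallyFinite :=
  fun x => (lattice_neighborSet_finite d x).fintype

section Walk

variable {V : Type*} [MeasurableSpace V] [DiscreteMeasurableSpace V] [Countable V]

/-- One step of simple random walk on a locally finite graph `G` from the vertex `v`: the uniform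
distribution on the neighbours of `v`. (At an isolated vertex, of which a lattice of positive
dimension has none, the walk stays put.) -/
noncomputable def stepLaw (G : SimpleGraph V) [G.LocallyFinite] (v : V) : Measure V :=
  open Classical in
  if h : (G.neighborFinset v).Nonempty then (PMF.uniformOfFinset (G.neighborFinset v) h).toMeasure
  else Measure.dirac v

instance stepLaw_isProbabilityMeasure (G : SimpleGraph V) [G.LocallyFinite] (v : V) :
    IsProbabilityMeasure (stepLaw G v) := by
  unfold stepLaw
  split_ifs <;> infer_instance

/-- The transition kernel from time `n` to time `n + 1`: given the whole path up to time `n`, the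
next vertex is distributed according to `stepLaw` at the current (time `n`) vertex. -/
noncomputable def stepKernel (G : SimpleGraph V) [G.LocallyFinite] (n : ℕ) :
    Kernel (Finset.Iic n → V) V where
  toFun path := stepLaw G (path ⟨n, Finset.mem_Iic.mpr le_rfl⟩)
  measurable' := (Measurable.of_discrete (f := stepLaw G)).comp (measurable_pi_apply _)

instance stepKernel_isMarkovKernel (G : SimpleGraph V) [G.LocallyFinite] (n : ℕ) :
    IsMarkovKernel (stepKernel G n) :=
  ⟨fun _ => inferInstanceAs (IsProbabilityMeasure (stepLaw G _))⟩

/-- The law, on the space of infinite paths `ω : ℕ → V`, of simple random walk on `G` started at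
the vertex `x`. -/
noncomputable def walkLaw (G : SimpleGraph V) [G.LocallyFinite] (x : V) : Measure (ℕ → V) :=
  Kernel.trajMeasure (X := fun _ : ℕ => V) (Measure.dirac x) (stepKernel G)

/-- The escape probability: the probability that simple random walk on `G` started at `x` never
returns to `x`. -/
noncomputable def escapeProb (G : SimpleGraph V) [G.LocallyFinite] (x : V) : ℝ :=
  (walkLaw G x).real {ω | ∀ n : ℕ, 1 ≤ n → ω n ≠ x}

/-- Simple random walk on `G` started at `x` is recurrent: it is certain to return to `x`. -/
def IsRecurrentAt (G : SimpleGraph V) [G.LocallyFinite] (x : V) : Prop :=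
  escapeProb G x = 0

/-- Simple random walk on `G` started at `x` is transient: with positive probability it never
returns to `x`. -/
def IsTransientAt (G : SimpleGraph V) [G.LocallyFinite] (x : V) : Prop :=
  0 < escapeProb G x

end Walk

end RandomWalk

/-!
Write `u n v` for the probability that the walk started at `v` avoids `x` at the times `1, …, n`.
Conditioning on the first step, `u (n + 1) v` is the average over the neighbours `w` of `v` of
`u n w`, with the term `w = x` replaced by `0` (`avoidProb`). The Markov property of the path
measure identifies `u n x` with the probability of the corresponding event for the law of the walk,
so `u n x` decreases to the escape probability (`tendsto_avoidProb_escapeProb`). The question is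
thereby reduced to one about averages over neighbours, and is settled by explicit superharmonic
functions.

*Recurrence* (`isRecurrentAt_of_superharmonic`). The probability of never visiting `x` is bounded by
`1`, vanishes at `x`, and is harmonic elsewhere. If `f ≥ 0` is superharmonic off `x` and tends to
infinity, the maximum principle bounds this probability by `ε f` for every `ε > 0`, so it is zero.
In dimension one `f v = |v - x|` serves, being harmonic off `x`. In dimension two
`f v = log (|v - x|² - 1/2)` does, up to an additive constant, once its value at `x` is made small
enough: for real `a, b` the product of `|w|² - 1/2` over the four neighbours `w` of `(a, b)` falls
short of `(a² + b² - 1/2)⁴` by exactly `4 (a² - b²)²` (`planarWeight_mul_le`).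

*Transience* (`isTransientAt_of_superharmonic`). If `g > 0` is superharmonic, the probability of
visiting `x` from `v` is at most `g v / g x`; averaging over the neighbours of `x`, the escape
probability is at least `1 - (mean of g around x) / g x`, which is positive if `g` is strictly
superharmonic at `x`. In dimension `d ≥ 3` one may take `g v = (C + |v - x|²)^(-α)` with
`0 < α < d/2 - 1` and `C` large; `α = 1/4` works for all these `d` (`sum_rpow_lt`).
-/

namespace RandomWalk
open scoped ENNReal Topology
open Filter

/-! ### Averages over neighbours -/

section NeighborMean

variable {V : Type*}

/-- The average of `φ` over the neighbours of `v`. Junk value `0` at an isolated vertex. -/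
noncomputable def neighborMean (G : SimpleGraph V) [G.LocallyFinite] (φ : V → ℝ) (v : V) : ℝ :=
  (∑ w ∈ G.neighborFinset v, φ w) / (G.neighborFinset v).card

theorem neighborMean_mono (G : SimpleGraph V) [G.LocallyFinite] {φ ψ : V → ℝ} (h : ∀ v, φ v ≤ ψ v)
    (v : V) : neighborMean G φ v ≤ neighborMean G ψ v :=
  div_le_div_of_nonneg_right (Finset.sum_le_sum fun w _ => h w) (Nat.cast_nonneg _)

theorem neighborMean_const (G : SimpleGraph V) [G.LocallyFinite] {v : V}
    (hv : (G.neighborFinset v).Nonempty) (c : ℝ) : neighborMean G (fun _ => c) v = c := by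
  have : ((G.neighborFinset v).card : ℝ) ≠ 0 := by exact_mod_cast hv.card_pos.ne'
  simp only [neighborMean, Finset.sum_const, nsmul_eq_mul]
  field_simp

theorem neighborMean_sub (G : SimpleGraph V) [G.LocallyFinite] (φ ψ : V → ℝ) (v : V) :
    neighborMean G (fun w => φ w - ψ w) v = neighborMean G φ v - neighborMean G ψ v := by
  simp only [neighborMean, Finset.sum_sub_distrib, sub_div]

theorem neighborMean_const_mul (G : SimpleGraph V) [G.LocallyFinite] (c : ℝ) (φ : V → ℝ) (v : V) :
    neighborMean G (fun w => c * φ w) v = c * neighborMean G φ v := by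
  simp only [neighborMean, ← Finset.mul_sum, mul_div_assoc]

/-- The probability that the walk started at `v` avoids `x` at the times `1, …, n`, defined by
conditioning on the first step. -/
noncomputable def avoidProb (G : SimpleGraph V) [G.LocallyFinite] (x : V) : ℕ → V → ℝ
  | 0 => fun _ => 1
  | n + 1 => neighborMean G (({x}ᶜ : Set V).indicator (avoidProb G x n))

theorem avoidProb_nonneg (G : SimpleGraph V) [G.LocallyFinite] (x : V) (n : ℕ) (v : V) :
    0 ≤ avoidProb G x n v := by
  induction n generalizing v with
  | zero => exact zero_le_one
  | succ n ih =>
    exact div_nonneg (Finset.sum_nonneg fun w _ => Set.indicator_nonneg (fun w _ => ih w) w)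
      (Nat.cast_nonneg _)

theorem avoidProb_antitone (G : SimpleGraph V) [G.LocallyFinite]
    (hG : ∀ v, (G.neighborFinset v).Nonempty) (x v : V) : Antitone fun n => avoidProb G x n v := by
  refine antitone_nat_of_succ_le fun n => ?_
  induction n generalizing v with
  | zero =>
    refine (neighborMean_mono G (fun w => ?_) v).trans_eq (neighborMean_const G (hG v) 1)
    exact Set.indicator_le_self' (fun _ _ => zero_le_one) w
  | succ n ih => exact neighborMean_mono G (fun w => Set.indicator_le_indicator (ih w)) v

/-- A function `F` that is subharmonic off `x`, nonpositive at `x`, and positive at only finitely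
many vertices is nonpositive, provided that no nonempty finite set of vertices is closed under
taking neighbours. -/
theorem nonpos_of_subharmonic (G : SimpleGraph V) [G.LocallyFinite]
    (hG : ∀ s : Set V, s.Finite → s.Nonempty → ∃ v ∈ s, ∃ w, G.Adj v w ∧ w ∉ s)
    (x : V) (F : V → ℝ) (hsub : ∀ v, v ≠ x → F v ≤ neighborMean G F v) (hx : F x ≤ 0)
    (hfin : {v | 0 < F v}.Finite) (v : V) : F v ≤ 0 := by
  by_contra! hv
  obtain ⟨a, ha, hmax⟩ := Set.exists_max_image _ F hfin ⟨v, hv⟩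
  have ha : 0 < F a := ha
  have hle : ∀ w, F w ≤ F a := fun w => by
    rcases le_or_gt (F w) 0 with h | h
    · exact h.trans ha.le
    · exact hmax w h
  -- The set where `F` attains its positive maximum is finite and does not contain `x`, yet
  -- subharmonicity would make it closed under taking neighbours.
  obtain ⟨b, hb, w, hbw, hw⟩ := hG {w | F w = F a}
    (hfin.subset fun w (hw : F w = F a) => ha.trans_eq hw.symm) ⟨a, rfl⟩
  have hb : F b = F a := hb
  have hbx : b ≠ x := by rintro rfl; linarith
  have hw' : w ∈ G.neighborFinset b := by simpa using hbw
  have hc : (0 : ℝ) < (G.neighborFinset b).card := by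
    exact_mod_cast Finset.card_pos.mpr ⟨w, hw'⟩
  have hlt : neighborMean G F b < F a := by
    rw [neighborMean, div_lt_iff₀ hc, mul_comm, ← nsmul_eq_mul, ← Finset.sum_const]
    exact Finset.sum_lt_sum (fun u _ => hle u) ⟨w, hw', lt_of_le_of_ne (hle w) hw⟩
  linarith [hsub b hbx]

end NeighborMean

/-! ### The law of the walk and the two criteria -/

section Walk

variable {V : Type*} [MeasurableSpace V] [DiscreteMeasurableSpace V]

theorem map_eval_zero_walkLaw (G : SimpleGraph V) [G.LocallyFinite] (x : V) :
    (walkLaw G x).map (fun ω => ω 0) = Measure.dirac x := by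
  have h : (fun ω : ℕ → V => ω 0) = (fun p : Finset.Iic 0 → V => p ⟨0, by simp⟩) ∘
      Preorder.frestrictLe (π := fun _ => V) 0 := rfl
  rw [walkLaw, Kernel.trajMeasure, Measure.map_dirac' (by fun_prop), Measure.dirac_bind
    (Kernel.measurable _), h, ← Measure.map_map (by fun_prop) (by fun_prop),
    Kernel.traj_map_frestrictLe_apply, Kernel.partialTraj_self, Kernel.id_apply,
    Measure.map_dirac' (by fun_prop)]
  rfl

instance isProbabilityMeasure_walkLaw (G : SimpleGraph V) [G.LocallyFinite] (x : V) :
    IsProbabilityMeasure (walkLaw G x) := by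
  unfold walkLaw; infer_instance

/-- The Markov property of the walk at time `n`. -/
theorem setLIntegral_walkLaw_succ (G : SimpleGraph V) [G.LocallyFinite] (x : V) (n : ℕ)
    {A : Set (Finset.Iic n → V)} (hA : MeasurableSet A) (φ : V → ℝ≥0∞) :
    ∫⁻ ω in (Preorder.frestrictLe (π := fun _ => V) n) ⁻¹' A, φ (ω (n + 1)) ∂walkLaw G x =
      ∫⁻ ω in (Preorder.frestrictLe (π := fun _ => V) n) ⁻¹' A,
        ∫⁻ w, φ w ∂stepLaw G (ω n) ∂walkLaw G x := by
  have hφ : Measurable φ := .of_discrete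
  have key := Kernel.map_frestrictLe_trajMeasure_compProd_eq_map_trajMeasure
    (X := fun _ : ℕ => V) (μ₀ := Measure.dirac x) (κ := stepKernel G) (a := n)
  have h := congrArg (fun m => ∫⁻ p in A ×ˢ Set.univ, φ p.2 ∂m) key
  rw [Measure.setLIntegral_compProd (by fun_prop) hA .univ,
    setLIntegral_map (hA.prod .univ) (by fun_prop) (by fun_prop)] at h
  simp only [Measure.restrict_univ] at h
  rw [setLIntegral_map hA hφ.lintegral_kernel (by fun_prop)] at h
  rw [show (fun ω : ℕ → V => (Preorder.frestrictLe n ω, ω (n + 1))) ⁻¹' A ×ˢ Set.univ =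
    (Preorder.frestrictLe (π := fun _ => V) n) ⁻¹' A by ext ω; simp] at h
  exact h.symm

variable [Countable V]

theorem lintegral_stepLaw (G : SimpleGraph V) [G.LocallyFinite] {v : V}
    (hv : (G.neighborFinset v).Nonempty) {φ : V → ℝ} (hφ : ∀ w, 0 ≤ φ w) :
    ∫⁻ w, ENNReal.ofReal (φ w) ∂stepLaw G v = ENNReal.ofReal (neighborMean G φ v) := by
  classical
  have hc : (0 : ℝ) < (G.neighborFinset v).card := by exact_mod_cast hv.card_pos
  rw [stepLaw, dif_pos hv, lintegral_countable']
  simp only [PMF.toMeasure_apply_singleton _ _ (measurableSet_singleton _),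
    PMF.uniformOfFinset_apply]
  rw [tsum_eq_sum (s := G.neighborFinset v) (fun w hw => by rw [if_neg hw, mul_zero]),
    neighborMean, ENNReal.ofReal_div_of_pos hc, ENNReal.ofReal_sum_of_nonneg fun w _ => hφ w,
    ENNReal.ofReal_natCast, div_eq_mul_inv, Finset.sum_mul]
  exact Finset.sum_congr rfl fun w hw => by rw [if_pos hw]

theorem measurableSet_eval_ne {ι : Type*} (k : ι) (x : V) :
    MeasurableSet {p : ι → V | p k ≠ x} :=
  (measurableSet_eq_fun (measurable_pi_apply k) measurable_const).compl

/-- With a terminal weight `avoidProb G x m` at time `n`, the walk is followed for `m` more steps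
without returning to `x`. -/
theorem setLIntegral_avoidProb (G : SimpleGraph V) [G.LocallyFinite]
    (hG : ∀ v, (G.neighborFinset v).Nonempty) (x : V) (n m : ℕ) :
    ∫⁻ ω in {ω | ∀ k, 1 ≤ k → k ≤ n → ω k ≠ x},
        ENNReal.ofReal (avoidProb G x m (ω n)) ∂walkLaw G x =
      ENNReal.ofReal (avoidProb G x (n + m) x) := by
  induction n generalizing m with
  | zero =>
    have h0 : {ω : ℕ → V | ∀ k, 1 ≤ k → k ≤ 0 → ω k ≠ x} = Set.univ :=
      Set.eq_univ_of_forall fun ω k h1 h2 => by omega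
    have hm : Measurable fun v => ENNReal.ofReal (avoidProb G x m v) := .of_discrete
    rw [h0, Measure.restrict_univ, ← lintegral_map (μ := walkLaw G x) (g := fun ω : ℕ → V => ω 0)
      hm (by fun_prop), map_eval_zero_walkLaw, lintegral_dirac, zero_add]
  | succ n ih =>
    have hA : MeasurableSet {p : Finset.Iic n → V | ∀ k : Finset.Iic n, 1 ≤ k.1 → p k ≠ x} := by
      simp only [Set.ofPred_forall]
      exact .iInter fun k => .iInter fun _ => measurableSet_eval_ne k x
    have hpre : (Preorder.frestrictLe (π := fun _ => V) n) ⁻¹'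
        {p : Finset.Iic n → V | ∀ k : Finset.Iic n, 1 ≤ k.1 → p k ≠ x} =
        {ω | ∀ k, 1 ≤ k → k ≤ n → ω k ≠ x} := by
      ext ω
      exact ⟨fun h k h1 h2 => h ⟨k, Finset.mem_Iic.mpr h2⟩ h1,
        fun h k h1 => h k.1 h1 (Finset.mem_Iic.mp k.2)⟩
    have hlast : MeasurableSet {ω : ℕ → V | ω (n + 1) ≠ x} :=
      measurableSet_eval_ne (n + 1) x
    have hsplit : {ω : ℕ → V | ∀ k, 1 ≤ k → k ≤ n + 1 → ω k ≠ x} =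
        {ω | ω (n + 1) ≠ x} ∩ {ω | ∀ k, 1 ≤ k → k ≤ n → ω k ≠ x} := by
      ext ω
      refine ⟨fun h => ⟨h _ (by omega) le_rfl, fun k h1 h2 => h k h1 (by omega)⟩,
        fun h k h1 h2 => ?_⟩
      rcases Nat.lt_or_ge n k with h3 | h3
      · obtain rfl : k = n + 1 := by omega
        exact h.1
      · exact h.2 k h1 h3
    have hind : ∀ ω : ℕ → V, {ω : ℕ → V | ω (n + 1) ≠ x}.indicator
        (fun ω => ENNReal.ofReal (avoidProb G x m (ω (n + 1)))) ω =
        (fun w => ENNReal.ofReal (({x}ᶜ : Set V).indicator (avoidProb G x m) w)) (ω (n + 1)) := by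
      intro ω
      by_cases h : ω (n + 1) = x <;> simp [Set.indicator, h]
    rw [hsplit, ← Measure.restrict_restrict hlast, ← lintegral_indicator hlast,
      lintegral_congr hind, ← hpre, setLIntegral_walkLaw_succ G x n hA
        (fun w => ENNReal.ofReal (({x}ᶜ : Set V).indicator (avoidProb G x m) w)), hpre]
    simp only [lintegral_stepLaw G (hG _)
      (fun w => Set.indicator_nonneg (fun w _ => avoidProb_nonneg G x m w) w)]
    rw [show n + 1 + m = n + (m + 1) by omega, ← ih (m + 1)]
    rfl

theorem tendsto_avoidProb_escapeProb (G : SimpleGraph V) [G.LocallyFinite]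
    (hG : ∀ v, (G.neighborFinset v).Nonempty) (x : V) :
    Tendsto (fun n => avoidProb G x n x) atTop (𝓝 (escapeProb G x)) := by
  have hS : ∀ n, (walkLaw G x).real {ω | ∀ k, 1 ≤ k → k ≤ n → ω k ≠ x} = avoidProb G x n x := by
    intro n
    have h := setLIntegral_avoidProb G hG x n 0
    simp only [avoidProb, ENNReal.ofReal_one, setLIntegral_one, add_zero] at h
    rw [measureReal_def, h, ENNReal.toReal_ofReal (avoidProb_nonneg G x n x)]
  have hI : {ω : ℕ → V | ∀ n, 1 ≤ n → ω n ≠ x} = ⋂ n, {ω | ∀ k, 1 ≤ k → k ≤ n → ω k ≠ x} := by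
    ext ω
    simp only [Set.mem_ofPred_eq, Set.mem_iInter]
    exact ⟨fun h n k h1 _ => h k h1, fun h n h1 => h n n h1 le_rfl⟩
  have hmeas : ∀ n, MeasurableSet {ω : ℕ → V | ∀ k, 1 ≤ k → k ≤ n → ω k ≠ x} := by
    intro n
    simp only [Set.ofPred_forall]
    exact .iInter fun k => .iInter fun _ => .iInter fun _ => measurableSet_eval_ne k x
  simp only [← hS, escapeProb, hI, measureReal_def]
  refine (ENNReal.tendsto_toReal (measure_ne_top _ _)).comp
    (tendsto_measure_iInter_atTop (fun n => (hmeas n).nullMeasurableSet) ?_ ⟨0, measure_ne_top _ _⟩)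
  exact fun m n hmn ω h k h1 h2 => h k h1 (h2.trans hmn)

/-- **Transience criterion**: a positive superharmonic function that is strictly superharmonic at
`x` makes the walk started at `x` transient. -/
theorem isTransientAt_of_superharmonic (G : SimpleGraph V) [G.LocallyFinite]
    (hG : ∀ v, (G.neighborFinset v).Nonempty) (x : V) (g : V → ℝ) (hg : ∀ v, 0 < g v)
    (hsuper : ∀ v, neighborMean G g v ≤ g v) (hx : neighborMean G g x < g x) :
    IsTransientAt G x := by
  -- From `v`, a visit to `x` at one of the times `1, …, n` has probability at most
  -- `(mean of g around v) / g x`.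
  have hstep : ∀ n v, 1 - (g x)⁻¹ * neighborMean G g v ≤ avoidProb G x n v := by
    intro n
    induction n with
    | zero =>
      intro v
      have : 0 ≤ neighborMean G g v :=
        div_nonneg (Finset.sum_nonneg fun w _ => (hg w).le) (Nat.cast_nonneg _)
      have := mul_nonneg (inv_nonneg.mpr (hg x).le) this
      simp only [avoidProb]
      linarith
    | succ n ih =>
      intro v
      rw [← neighborMean_const_mul]
      nth_rw 1 [← neighborMean_const G (hG v) 1]
      rw [← neighborMean_sub]
      refine neighborMean_mono G (fun w => ?_) v
      by_cases hw : w = x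
      · subst hw
        simp [(hg w).ne']
      · rw [Set.indicator_of_mem (by simpa using hw)]
        exact (sub_le_sub_left
          (mul_le_mul_of_nonneg_left (hsuper w) (inv_nonneg.mpr (hg x).le)) 1).trans (ih w)
  have hpos : 0 < 1 - (g x)⁻¹ * neighborMean G g x := by
    rw [sub_pos, inv_mul_lt_iff₀ (hg x), mul_one]
    exact hx
  exact hpos.trans_le (ge_of_tendsto' (tendsto_avoidProb_escapeProb G hG x) fun n => hstep n x)

/-- **Recurrence criterion**: a nonnegative function that tends to infinity and is superharmonic off
`x` makes the walk started at `x` recurrent. -/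
theorem isRecurrentAt_of_superharmonic (G : SimpleGraph V) [G.LocallyFinite]
    (hG : ∀ s : Set V, s.Finite → s.Nonempty → ∃ v ∈ s, ∃ w, G.Adj v w ∧ w ∉ s)
    (x : V) (f : V → ℝ) (hf : ∀ v, 0 ≤ f v) (hfin : ∀ M, {v | f v ≤ M}.Finite)
    (hsuper : ∀ v, v ≠ x → neighborMean G f v ≤ f v) : IsRecurrentAt G x := by
  have hne : ∀ v, (G.neighborFinset v).Nonempty := fun v => by
    obtain ⟨_, rfl, w, hw, -⟩ := hG {v} (Set.finite_singleton v) ⟨v, rfl⟩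
    exact ⟨w, by simpa using hw⟩
  have hbdd : ∀ v, BddBelow (Set.range fun n => avoidProb G x n v) := fun v =>
    ⟨0, by rintro _ ⟨n, rfl⟩; exact avoidProb_nonneg G x n v⟩
  -- `u v` is the probability of never being at `x` at a positive time, starting from `v`.
  set u : V → ℝ := fun v => ⨅ n, avoidProb G x n v with hu
  have hlim : ∀ v, Tendsto (fun n => avoidProb G x n v) atTop (𝓝 (u v)) := fun v =>
    tendsto_atTop_ciInf (avoidProb_antitone G hne x v) (hbdd v)
  have hu1 : ∀ v, u v ≤ 1 := fun v => ciInf_le (hbdd v) 0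
  have hu0 : ∀ v, 0 ≤ u v := fun v => le_ciInf fun n => avoidProb_nonneg G x n v
  set h : V → ℝ := ({x}ᶜ : Set V).indicator u with hh
  have hx : h x = 0 := by simp [hh]
  have hoff : ∀ v, v ≠ x → h v = u v := fun v hv => Set.indicator_of_mem (by simpa using hv) u
  have hle1 : ∀ v, h v ≤ 1 := fun v => by
    by_cases hv : v = x
    · rw [hv, hx]; exact zero_le_one
    · rw [hoff v hv]; exact hu1 v
  have hfix : ∀ v, u v = neighborMean G h v := fun v => by
    refine tendsto_nhds_unique ((tendsto_add_atTop_iff_nat 1).mpr (hlim v)) ?_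
    refine Tendsto.div_const (tendsto_finsetSum _ fun w _ => ?_) _
    by_cases hw : w = x
    · subst hw
      simp [hh]
    · simpa only [hh, Set.indicator_of_mem (show w ∈ ({x}ᶜ : Set V) by simpa using hw)] using hlim w
  -- Compare `h` with `ε f` for every `ε > 0`: off a finite set `ε f` exceeds `1`.
  have hcomp : ∀ ε > 0, ∀ v, h v ≤ ε * f v := fun ε hε v => by
    refine sub_nonpos.mp (nonpos_of_subharmonic G hG x (fun v => h v - ε * f v) ?_ ?_ ?_ v)
    · intro v hv
      rw [neighborMean_sub, neighborMean_const_mul, ← hfix, hoff v hv]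
      exact sub_le_sub_left (mul_le_mul_of_nonneg_left (hsuper v hv) hε.le) _
    · rw [hx, zero_sub]
      exact neg_nonpos.mpr (mul_nonneg hε.le (hf x))
    · refine (hfin ε⁻¹).subset fun v (hv : 0 < h v - ε * f v) => ?_
      have h1 : ε * f v ≤ 1 := by linarith [hle1 v]
      simpa using (le_div_iff₀' hε).mpr h1
  have hzero : ∀ v, h v ≤ 0 := fun v => by
    have ht : Tendsto (fun ε : ℝ => ε * f v) (𝓝[>] 0) (𝓝 (0 * f v)) :=
      (tendsto_id.mono_left nhdsWithin_le_nhds).mul_const _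
    rw [zero_mul] at ht
    exact ge_of_tendsto ht (eventually_mem_nhdsWithin.mono fun ε hε => hcomp ε hε v)
  have hux : u x ≤ 0 :=
    (hfix x).trans_le ((neighborMean_mono G hzero x).trans_eq (neighborMean_const G (hne x) 0))
  rw [IsRecurrentAt, tendsto_nhds_unique (tendsto_avoidProb_escapeProb G hne x) (hlim x)]
  exact le_antisymm hux (hu0 x)

end Walk

/-! ### The integer lattice -/

theorem lattice_adj_iff {d : ℕ} {v w : Fin d → ℤ} :
    (lattice d).Adj v w ↔ ∃ i, ∃ s ∈ ({1, -1} : Finset ℤ), v + Pi.single i s = w := by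
  change ∑ i, |v i - w i| = 1 ↔ _
  constructor
  · intro h
    obtain ⟨i, -, hi⟩ : ∃ i ∈ Finset.univ, |v i - w i| ≠ 0 :=
      Finset.exists_ne_zero_of_sum_ne_zero (by rw [h]; exact one_ne_zero)
    rw [← Finset.add_sum_erase _ _ (Finset.mem_univ i)] at h
    have hr := Finset.sum_nonneg fun j (_ : j ∈ Finset.univ.erase i) => abs_nonneg (v j - w j)
    have hp := abs_nonneg (v i - w i)
    have hr0 : ∑ j ∈ Finset.univ.erase i, |v j - w j| = 0 := by omega
    have h1 : |v i - w i| = 1 := by omega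
    refine ⟨i, w i - v i, ?_, ?_⟩
    · rcases abs_eq zero_le_one |>.mp h1 with h1 | h1 <;> simp <;> omega
    · ext j
      by_cases hj : j = i
      · subst hj
        simp
      · have := (Finset.sum_eq_zero_iff_of_nonneg fun j _ => abs_nonneg _).mp hr0 j (by simp [hj])
        rw [abs_eq_zero] at this
        simp [hj]
        omega
  · rintro ⟨i, s, hs, rfl⟩
    rw [Finset.sum_eq_single i (fun j _ hj => by simp [hj]) (by simp)]
    simp at hs
    rcases hs with rfl | rfl <;> simp

theorem sum_neighborFinset_lattice {d : ℕ} (φ : (Fin d → ℤ) → ℝ) (v : Fin d → ℤ) :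
    ∑ w ∈ (lattice d).neighborFinset v, φ w =
      ∑ i, (φ (v + Pi.single i 1) + φ (v + Pi.single i (-1))) := by
  have h : ∑ p ∈ (Finset.univ : Finset (Fin d)) ×ˢ ({1, -1} : Finset ℤ),
      φ (v + Pi.single p.1 p.2) = ∑ w ∈ (lattice d).neighborFinset v, φ w := by
    refine Finset.sum_bij (fun p _ => v + Pi.single p.1 p.2) ?_ ?_ ?_ fun _ _ => rfl
    · intro p hp
      rw [SimpleGraph.mem_neighborFinset, lattice_adj_iff]
      exact ⟨p.1, p.2, (Finset.mem_product.mp hp).2, rfl⟩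
    · rintro ⟨i, s⟩ hp ⟨j, t⟩ hq hpq
      have hs : s ≠ 0 := by
        rintro rfl
        simp at hp
      have hpq : Pi.single i s = (Pi.single j t : Fin d → ℤ) := add_left_cancel hpq
      have hi := congrFun hpq i
      rw [Pi.single_eq_same, Pi.single_apply] at hi
      split_ifs at hi with hij
      · rw [hij, hi]
      · exact absurd hi hs
    · intro w hw
      rw [SimpleGraph.mem_neighborFinset, lattice_adj_iff] at hw
      obtain ⟨i, s, hs, rfl⟩ := hw
      exact ⟨(i, s), Finset.mem_product.mpr ⟨Finset.mem_univ i, hs⟩, rfl⟩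
  rw [← h, Finset.sum_product]
  exact Finset.sum_congr rfl fun i _ => Finset.sum_pair (by decide)

theorem neighborMean_lattice {d : ℕ} (φ : (Fin d → ℤ) → ℝ) (v : Fin d → ℤ) :
    neighborMean (lattice d) φ v =
      (∑ i, (φ (v + Pi.single i 1) + φ (v + Pi.single i (-1)))) / (2 * d) := by
  have hc : (((lattice d).neighborFinset v).card : ℝ) = 2 * d := by
    have := sum_neighborFinset_lattice (fun _ => 1) v
    simp only [Finset.sum_const, nsmul_eq_mul, mul_one, Finset.card_univ, Fintype.card_fin] at this
    rw [this]
    ring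
  rw [neighborMean, sum_neighborFinset_lattice, hc]

theorem lattice_exists_adj_notMem {d : ℕ} (hd : 0 < d) (s : Set (Fin d → ℤ)) (hs : s.Finite)
    (hne : s.Nonempty) : ∃ v ∈ s, ∃ w, (lattice d).Adj v w ∧ w ∉ s := by
  obtain ⟨v, hv, hmax⟩ := Set.exists_max_image s (fun v => v ⟨0, hd⟩) hs hne
  refine ⟨v, hv, v + Pi.single ⟨0, hd⟩ 1, lattice_adj_iff.mpr ⟨_, 1, by simp, rfl⟩, fun h => ?_⟩
  have := hmax _ h
  simp at this

theorem lattice_neighborFinset_nonempty {d : ℕ} (hd : 0 < d) (v : Fin d → ℤ) :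
    ((lattice d).neighborFinset v).Nonempty :=
  ⟨v + Pi.single ⟨0, hd⟩ 1, by
    rw [SimpleGraph.mem_neighborFinset, lattice_adj_iff]; exact ⟨_, 1, by simp, rfl⟩⟩

theorem finite_setOf_sum_sq_le {d : ℕ} (x : Fin d → ℤ) (R : ℝ) :
    {v : Fin d → ℤ | ∑ i, ((v i - x i : ℤ) : ℝ) ^ 2 ≤ R}.Finite := by
  refine (Set.finite_Icc (fun i => x i - ⌈R⌉) (fun i => x i + ⌈R⌉)).subset fun v hv => ?_
  have hv : ∑ i, ((v i - x i : ℤ) : ℝ) ^ 2 ≤ R := hv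
  have h : ∀ i, |v i - x i| ≤ ⌈R⌉ := fun i => by
    have h1 := (Finset.single_le_sum (f := fun i => ((v i - x i : ℤ) : ℝ) ^ 2)
      (fun j _ => sq_nonneg _) (Finset.mem_univ i)).trans (hv.trans (Int.le_ceil R))
    have h2 : (v i - x i) ^ 2 ≤ ⌈R⌉ := by exact_mod_cast h1
    have h3 := Int.natAbs_le_self_sq (v i - x i)
    rw [Int.natCast_natAbs] at h3
    exact h3.trans h2
  constructor <;> intro i <;> have := abs_le.mp (h i) <;> simp only <;> omega

/-! ### Dimension one -/

theorem isRecurrentAt_lattice_one (x : Fin 1 → ℤ) : IsRecurrentAt (lattice 1) x := by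
  refine isRecurrentAt_of_superharmonic (lattice 1) (lattice_exists_adj_notMem one_pos) x
    (fun v => ((|v 0 - x 0| : ℤ) : ℝ)) (fun v => by positivity) (fun M => ?_) fun v hv => ?_
  · refine (finite_setOf_sum_sq_le x (M ^ 2)).subset fun v hv => ?_
    have hv : ((|v 0 - x 0| : ℤ) : ℝ) ≤ M := hv
    rw [Set.mem_ofPred_eq, Fin.sum_univ_one, ← sq_abs, ← Int.cast_abs]
    exact pow_le_pow_left₀ (by positivity) hv 2
  · rw [neighborMean_lattice, Fin.sum_univ_one]
    have hv0 : v 0 ≠ x 0 := fun h => hv (funext fun i => by rw [Subsingleton.elim i 0, h])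
    have h : |v 0 + 1 - x 0| + |v 0 + -1 - x 0| ≤ 2 * |v 0 - x 0| := by grind
    have h' : ((|v 0 + 1 - x 0| : ℤ) : ℝ) + ((|v 0 + -1 - x 0| : ℤ) : ℝ)
      ≤ 2 * ((|v 0 - x 0| : ℤ) : ℝ) := by exact_mod_cast h
    simp only [Pi.add_apply, Pi.single_eq_same, Nat.cast_one, mul_one]
    linarith

/-! ### Dimension two -/

/-- The function `a² + b² - 1/2` on `ℤ²`, with its value at the origin replaced by a small positive
number. Its logarithm is superharmonic off the origin; `1/126` is the largest value at the origin
for which this holds at the four neighbours, since `1/126 * 7/2 * 3/2 * 3/2 = (1/2)^4`. -/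
noncomputable def planarWeight (a b : ℤ) : ℝ :=
  if a = 0 ∧ b = 0 then 1 / 126 else (a : ℝ) ^ 2 + (b : ℝ) ^ 2 - 1 / 2

theorem half_le_planarWeight {a b : ℤ} (h : ¬(a = 0 ∧ b = 0)) : 1 / 2 ≤ planarWeight a b := by
  rw [planarWeight, if_neg h]
  have h1 : 1 ≤ a ^ 2 + b ^ 2 := by
    by_contra! h2
    exact h ⟨by nlinarith [sq_nonneg b], by nlinarith [sq_nonneg a]⟩
  have h2 : (1 : ℝ) ≤ (a : ℝ) ^ 2 + (b : ℝ) ^ 2 := by exact_mod_cast h1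
  linarith

theorem le_planarWeight (a b : ℤ) : 1 / 126 ≤ planarWeight a b := by
  by_cases h : a = 0 ∧ b = 0
  · rw [planarWeight, if_pos h]
  · linarith [half_le_planarWeight h]

/-- Off the origin, the geometric mean of `planarWeight` over the four neighbours is at most its
value. -/
theorem planarWeight_mul_le {a b : ℤ} (h : ¬(a = 0 ∧ b = 0)) :
    planarWeight (a + 1) b * planarWeight (a - 1) b *
      (planarWeight a (b + 1) * planarWeight a (b - 1)) ≤ planarWeight a b ^ 4 := by
  -- If the origin is one of the neighbours, its small weight decides; there are four such points.
  by_cases h1 : a + 1 = 0 ∧ b = 0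
  · obtain ⟨rfl, rfl⟩ : a = -1 ∧ b = 0 := ⟨by omega, h1.2⟩
    norm_num [planarWeight]
  by_cases h2 : a - 1 = 0 ∧ b = 0
  · obtain ⟨rfl, rfl⟩ : a = 1 ∧ b = 0 := ⟨by omega, h2.2⟩
    norm_num [planarWeight]
  by_cases h3 : a = 0 ∧ b + 1 = 0
  · obtain ⟨rfl, rfl⟩ : a = 0 ∧ b = -1 := ⟨h3.1, by omega⟩
    norm_num [planarWeight]
  by_cases h4 : a = 0 ∧ b - 1 = 0
  · obtain ⟨rfl, rfl⟩ : a = 0 ∧ b = 1 := ⟨h4.1, by omega⟩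
    norm_num [planarWeight]
  simp only [planarWeight, if_neg h, if_neg h1, if_neg h2, if_neg h3, if_neg h4]
  push_cast
  -- With the constant `1/2` the difference of the two sides is exactly `4 (a² - b²)²`.
  linarith [show (((a : ℝ) ^ 2 + (b : ℝ) ^ 2 - 1 / 2) ^ 4 -
    (((a : ℝ) + 1) ^ 2 + (b : ℝ) ^ 2 - 1 / 2) * (((a : ℝ) - 1) ^ 2 + (b : ℝ) ^ 2 - 1 / 2) *
    (((a : ℝ) ^ 2 + ((b : ℝ) + 1) ^ 2 - 1 / 2) * ((a : ℝ) ^ 2 + ((b : ℝ) - 1) ^ 2 - 1 / 2))) =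
    4 * ((a : ℝ) ^ 2 - (b : ℝ) ^ 2) ^ 2 by ring, sq_nonneg ((a : ℝ) ^ 2 - (b : ℝ) ^ 2)]

/-- The factor `126` makes the logarithms nonnegative. -/
theorem log_planarWeight_superharmonic {a b : ℤ} (h : ¬(a = 0 ∧ b = 0)) :
    Real.log (126 * planarWeight (a + 1) b) + Real.log (126 * planarWeight (a - 1) b) +
      (Real.log (126 * planarWeight a (b + 1)) + Real.log (126 * planarWeight a (b - 1))) ≤
      4 * Real.log (126 * planarWeight a b) := by
  have hp : ∀ a b, 0 < 126 * planarWeight a b := fun a b => by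
    linarith [le_planarWeight a b]
  rw [← Real.log_mul (hp _ _).ne' (hp _ _).ne', ← Real.log_mul (hp _ _).ne' (hp _ _).ne',
    ← Real.log_mul (mul_pos (hp _ _) (hp _ _)).ne' (mul_pos (hp _ _) (hp _ _)).ne',
    show (4 : ℝ) = (4 : ℕ) by norm_num, ← Real.log_pow]
  refine Real.log_le_log (mul_pos (mul_pos (hp _ _) (hp _ _)) (mul_pos (hp _ _) (hp _ _))) ?_
  have := planarWeight_mul_le h
  rw [mul_pow]
  linarith

theorem isRecurrentAt_lattice_two (x : Fin 2 → ℤ) : IsRecurrentAt (lattice 2) x := by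
  refine isRecurrentAt_of_superharmonic (lattice 2) (lattice_exists_adj_notMem two_pos) x
    (fun v => Real.log (126 * planarWeight (v 0 - x 0) (v 1 - x 1)))
    (fun v => Real.log_nonneg (by linarith [le_planarWeight (v 0 - x 0) (v 1 - x 1)]))
    (fun M => ?_) fun v hv => ?_
  · refine (finite_setOf_sum_sq_le x (Real.exp M + 1 / 2)).subset fun v hv => ?_
    have hp : 0 < 126 * planarWeight (v 0 - x 0) (v 1 - x 1) := by
      linarith [le_planarWeight (v 0 - x 0) (v 1 - x 1)]
    have hv : 126 * planarWeight (v 0 - x 0) (v 1 - x 1) ≤ Real.exp M :=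
      (Real.log_le_iff_le_exp hp).mp hv
    rw [Set.mem_ofPred_eq, Fin.sum_univ_two]
    by_cases h : v 0 - x 0 = 0 ∧ v 1 - x 1 = 0
    · rw [h.1, h.2]
      have := Real.exp_pos M
      norm_num
      linarith
    · rw [planarWeight, if_neg h] at hv hp
      linarith
  · have h : ¬(v 0 - x 0 = 0 ∧ v 1 - x 1 = 0) := fun h => hv <| funext fun i => by
      fin_cases i
      · exact sub_eq_zero.mp h.1
      · exact sub_eq_zero.mp h.2
    have key := log_planarWeight_superharmonic h
    rw [neighborMean_lattice, Fin.sum_univ_two, div_le_iff₀ (by norm_num)]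
    simp only [Pi.add_apply, Pi.single_eq_same, Pi.single_eq_of_ne (zero_ne_one (α := Fin 2)),
      Pi.single_eq_of_ne (one_ne_zero (α := Fin 2)), add_zero, ← sub_eq_add_neg, Nat.cast_ofNat,
      sub_right_comm _ (1 : ℤ), add_sub_right_comm _ (1 : ℤ)]
    linarith

/-! ### Dimension at least three -/

/-- The second-order Taylor bound for `(1 + t)^(-1/4)`, with the coefficient `10/64` of `t²`
enlarged to `11/64` so as to hold for all small `t`. Any coefficient below `d/16`, hence any
below `12/64` when `d ≥ 3`, still yields superharmonicity in `sum_rpow_lt`. -/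
theorem one_add_rpow_le {t : ℝ} (ht : |t| ≤ 1 / 16) :
    (1 + t) ^ (-(1 / 4) : ℝ) ≤ 1 - t / 4 + 11 / 64 * t ^ 2 := by
  obtain ⟨h1, h2⟩ := abs_le.mp ht
  have hp : 0 < 1 - t / 4 + 11 / 64 * t ^ 2 := by nlinarith [sq_nonneg t]
  have ht0 : 0 < 1 + t := by linarith
  have hq : 1 ≤ (1 + t) * (1 - t / 4 + 11 / 64 * t ^ 2) ^ 4 := by
    -- Square twice, discarding powers of `t` beyond the second, then the third, at the cost of
    -- slightly smaller coefficients.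
    have ht1 : 0 ≤ 1 / 16 - t := by linarith
    have ht2 : 0 ≤ 1 / 16 + t := by linarith
    have hs := sq_nonneg t
    have e1 : 1 - t / 2 + 51 / 128 * t ^ 2 ≤ (1 - t / 4 + 11 / 64 * t ^ 2) ^ 2 := by
      nlinarith [mul_nonneg hs ht1, mul_nonneg hs hs]
    have hq : 0 ≤ 1 - t / 2 + 51 / 128 * t ^ 2 := by linarith
    have e2 : 1 - t + 67 / 64 * t ^ 2 - 51 / 128 * t ^ 3 ≤
        (1 - t / 2 + 51 / 128 * t ^ 2) ^ 2 := by
      nlinarith [mul_nonneg hs hs]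
    have e3 : 1 ≤ (1 + t) * (1 - t + 67 / 64 * t ^ 2 - 51 / 128 * t ^ 3) := by
      nlinarith [mul_nonneg hs ht2, mul_nonneg hs (mul_nonneg ht1 ht2)]
    have e4 := pow_le_pow_left₀ hq e1 2
    calc 1 ≤ _ := e3
      _ ≤ _ := mul_le_mul_of_nonneg_left (e2.trans (e4.trans_eq (by ring))) ht0.le
  rw [Real.rpow_neg ht0.le, inv_le_comm₀ (Real.rpow_pos_of_pos ht0 _) hp]
  have h3 : ((1 - t / 4 + 11 / 64 * t ^ 2)⁻¹ ^ 4) ^ (1 / 4 : ℝ) =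
      (1 - t / 4 + 11 / 64 * t ^ 2)⁻¹ := by
    rw [one_div, show (4 : ℝ) = (4 : ℕ) by norm_num]
    exact Real.pow_rpow_inv_natCast (inv_nonneg.mpr hp.le) (by norm_num)
  rw [← h3]
  refine Real.rpow_le_rpow (by positivity) ?_ (by norm_num)
  rw [inv_pow, inv_le_iff_one_le_mul₀ (by positivity)]
  exact hq

theorem add_rpow_le {s τ : ℝ} (hs : 0 < s) (hτ : |τ| ≤ s / 16) :
    (s + τ) ^ (-(1 / 4) : ℝ) ≤
      s ^ (-(1 / 4) : ℝ) * (1 - τ / s / 4 + 11 / 64 * (τ / s) ^ 2) := by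
  have ht : |τ / s| ≤ 1 / 16 := by
    rw [abs_div, abs_of_pos hs, div_le_iff₀ hs]
    linarith
  have h0 : 0 ≤ 1 + τ / s := by linarith [(abs_le.mp ht).1]
  rw [show s + τ = s * (1 + τ / s) by field_simp, Real.mul_rpow hs.le h0]
  exact mul_le_mul_of_nonneg_left (one_add_rpow_le ht) (Real.rpow_nonneg hs.le _)

/-- For `d ≥ 3` the function `(C + |y|²)^(-1/4)` is strictly superharmonic on `ℤ^d` when the
constant `C` is large. -/
theorem sum_rpow_lt {d : ℕ} (hd : 2 < d) (y : Fin d → ℝ) {s : ℝ}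
    (hs : s = (d + 272) + ∑ i, y i ^ 2) :
    ∑ i, ((s + (1 + 2 * y i)) ^ (-(1 / 4) : ℝ) + (s + (1 - 2 * y i)) ^ (-(1 / 4) : ℝ)) <
      2 * d * s ^ (-(1 / 4) : ℝ) := by
  have hd3 : (3 : ℝ) ≤ d := by exact_mod_cast hd
  have hsum : 0 ≤ ∑ i, y i ^ 2 := Finset.sum_nonneg fun i _ => sq_nonneg _
  have hs0 : 0 < s := by linarith
  have hr : 0 < s ^ (-(1 / 4) : ℝ) := Real.rpow_pos_of_pos hs0 _
  -- `1 + 2 |y i| ≤ s / 16` follows from `(|y i| - 16)² ≥ 0` because `272 = 16² + 16`.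
  have hsmall : ∀ i, 1 + 2 * |y i| ≤ s / 16 := fun i => by
    have := Finset.single_le_sum (f := fun i => y i ^ 2) (fun j _ => sq_nonneg _)
      (Finset.mem_univ i)
    have h2 := sq_nonneg (|y i| - 16)
    have h3 := sq_abs (y i)
    nlinarith
  have hterm : ∀ i ∈ Finset.univ,
      (s + (1 + 2 * y i)) ^ (-(1 / 4) : ℝ) + (s + (1 - 2 * y i)) ^ (-(1 / 4) : ℝ) ≤
      s ^ (-(1 / 4) : ℝ) * (2 - 1 / (2 * s) + 11 / 32 / s ^ 2 + 11 / 8 / s ^ 2 * y i ^ 2) := by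
    intro i _
    have ha := neg_abs_le (y i)
    have hb := le_abs_self (y i)
    have h1 := add_rpow_le (τ := 1 + 2 * y i) hs0
      (abs_le.mpr ⟨by linarith [hsmall i], by linarith [hsmall i]⟩)
    have h2 := add_rpow_le (τ := 1 - 2 * y i) hs0
      (abs_le.mpr ⟨by linarith [hsmall i], by linarith [hsmall i]⟩)
    refine (add_le_add h1 h2).trans_eq ?_
    field_simp
    ring
  refine (Finset.sum_le_sum hterm).trans_lt ?_
  rw [← Finset.mul_sum, Finset.sum_add_distrib, ← Finset.mul_sum, Finset.sum_const,
    Finset.card_univ, Fintype.card_fin, nsmul_eq_mul, mul_comm (2 * (d : ℝ))]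
  refine mul_lt_mul_of_pos_left ?_ hr
  have hq : ∑ i, y i ^ 2 = s - (d + 272) := by linarith
  rw [hq, ← sub_pos]
  have : 2 * (d : ℝ) - (d * (2 - 1 / (2 * s) + 11 / 32 / s ^ 2) +
      11 / 8 / s ^ 2 * (s - (d + 272))) =
      ((d / 2 - 11 / 8) * s + (11 / 8 * 272 + 33 / 32 * d)) / s ^ 2 := by
    field_simp
    ring
  rw [this]
  refine div_pos (add_pos (mul_pos (by linarith) hs0) (by linarith)) (by positivity)

theorem isTransientAt_lattice {d : ℕ} (hd : 2 < d) (x : Fin d → ℤ) :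
    IsTransientAt (lattice d) x := by
  have hd0 : 0 < d := by omega
  set N : (Fin d → ℤ) → ℝ := fun v => (d + 272) + ∑ i, ((v i - x i : ℤ) : ℝ) ^ 2 with hN
  have hNpos : ∀ v, 0 < N v := fun v => by positivity
  have hshift : ∀ v i (s : ℤ), N (v + Pi.single i s) =
      N v + ((s : ℝ) ^ 2 + 2 * s * ((v i - x i : ℤ) : ℝ)) := by
    intro v i s
    have h : ∑ j ∈ Finset.univ.erase i, (((v + Pi.single i s : Fin d → ℤ) j - x j : ℤ) : ℝ) ^ 2 =
        ∑ j ∈ Finset.univ.erase i, ((v j - x j : ℤ) : ℝ) ^ 2 :=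
      Finset.sum_congr rfl fun j hj => by
        rw [Pi.add_apply, Pi.single_eq_of_ne (Finset.ne_of_mem_erase hj), add_zero]
    simp only [hN]
    rw [← Finset.add_sum_erase _ _ (Finset.mem_univ i), h,
      ← Finset.add_sum_erase (a := i) _ (fun j => ((v j - x j : ℤ) : ℝ) ^ 2) (Finset.mem_univ i),
      Pi.add_apply, Pi.single_eq_same]
    push_cast
    ring
  have hlt : ∀ v, neighborMean (lattice d) (fun v => N v ^ (-(1 / 4) : ℝ)) v <
      N v ^ (-(1 / 4) : ℝ) := fun v => by
    rw [neighborMean_lattice, div_lt_iff₀ (by positivity), mul_comm _ (2 * (d : ℝ))]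
    refine lt_of_eq_of_lt (Finset.sum_congr rfl fun i _ => ?_)
      (sum_rpow_lt hd (fun i => ((v i - x i : ℤ) : ℝ)) (s := N v) rfl)
    have hp := hshift v i 1
    have hm := hshift v i (-1)
    norm_num [neg_mul, ← sub_eq_add_neg] at hp hm
    norm_num [hp, hm]
  exact isTransientAt_of_superharmonic (lattice d) (lattice_neighborFinset_nonempty hd0) x
    (fun v => N v ^ (-(1 / 4) : ℝ)) (fun v => Real.rpow_pos_of_pos (hNpos v) _)
    (fun v => (hlt v).le) (hlt x)

end RandomWalk

theorem mainTheorem1 (d : ℕ) (x : Fin d → ℤ) :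
    ((d = 1 ∨ d = 2) → RandomWalk.IsRecurrentAt (RandomWalk.lattice d) x) ∧
      (2 < d → RandomWalk.IsTransientAt (RandomWalk.lattice d) x) := by
  refine ⟨?_, fun hd => RandomWalk.isTransientAt_lattice hd x⟩
  rintro (rfl | rfl)
  · exact RandomWalk.isRecurrentAt_lattice_one x
  · exact RandomWalk.isRecurrentAt_lattice_two x
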